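/- Let $\Omega\subseteq\mathbb{C}$ be a nonempty open set, and let $\mathcal{M}(\Omega)$ be the abstract (untopologized) commutative ring of meromorphic functions on $\Omega$ with pointwise addition and multiplication, where two meromorphic functions are identified if they agree off a set with no accumulation point in $\Omega$. If $\Omega$ is connected, then $\mathcal{M}(\Omega)$ is a field. For every nonempty open $\Omega$, there is no Polish (separable, completely metrizable) topology on $\mathcal{M}(\Omega)$ that makes $\mathcal{M}(\Omega)$ a topological ring. In particular, for connected $\Omega$ the field $\mathcal{M}(\Omega)$ cannot be made into a Polish field. -/

import Mathlib

open Filter Topology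

/-- The abstract (untopologized) commutative ring `ℳ(Ω)` of meromorphic functions on `Ω ⊆ ℂ`, with
pointwise addition and multiplication. Functions that are meromorphic at each point of `Ω` are
identified when they agree off a subset of `Ω` without accumulation points in `Ω`; the arbitrary
values at poles, at removable singularities and outside `Ω` are thereby forgotten. -/
def MeromorphicFunctions (Ω : Set ℂ) : Subring (Germ (codiscreteWithin Ω) ℂ) where
  carrier := {g | ∃ f : ℂ → ℂ, MeromorphicOn f Ω ∧ (f : Germ (codiscreteWithin Ω) ℂ) = g}
  mul_mem' := by
    rintro _ _ ⟨f, hf, rfl⟩ ⟨g, hg, rfl⟩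
    exact ⟨f * g, hf.mul hg, rfl⟩
  one_mem' := ⟨1, MeromorphicOn.const 1, rfl⟩
  add_mem' := by
    rintro _ _ ⟨f, hf, rfl⟩ ⟨g, hg, rfl⟩
    exact ⟨f + g, hf.add hg, rfl⟩
  zero_mem' := ⟨0, MeromorphicOn.const 0, rfl⟩
  neg_mem' := by
    rintro _ ⟨f, hf, rfl⟩
    exact ⟨-f, hf.neg, rfl⟩

/-- For a nonempty connected open set `Ω`
the ring `ℳ(Ω)` is a field. -/
theorem MeromorphicFunctions.isField {Ω : Set ℂ} (hΩ : IsOpen Ω) (hc : IsConnected Ω) :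
    IsField (MeromorphicFunctions Ω) := by
  have key : ∀ f : ℂ → ℂ, MeromorphicOn f Ω → ∀ x ∈ Ω, meromorphicOrderAt f x = ⊤ →
      f =ᶠ[codiscreteWithin Ω] 0 := by
    intro f hf x hx h
    have hall : ∀ y ∈ Ω, meromorphicOrderAt f y = ⊤ := by
      intro y hy
      by_contra hne
      exact hf.meromorphicOrderAt_ne_top_of_isPreconnected hc.isPreconnected hy hx hne h
    rw [EventuallyEq, Filter.Eventually, mem_codiscreteWithin_iff_forall_mem_nhdsNE]
    intro y hy
    have := meromorphicOrderAt_eq_top_iff.1 (hall y hy)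
    filter_upwards [this] with z hz
    exact Or.inl hz
  refine ⟨?_, mul_comm, ?_⟩
  · refine ⟨0, 1, ?_⟩
    intro h
    obtain ⟨x, hx⟩ := hc.nonempty
    have h1 : ((0 : ℂ → ℂ) : Germ (codiscreteWithin Ω) ℂ) = ((1 : ℂ → ℂ) : Germ _ ℂ) :=
      congrArg Subtype.val h
    have h2 := Germ.coe_eq.1 h1
    rw [EventuallyEq, Filter.Eventually, mem_codiscreteWithin_iff_forall_mem_nhdsNE] at h2
    have h3 := h2 x hx
    have h4 : Ω ∈ 𝓝[≠] x := mem_nhdsWithin_of_mem_nhds (hΩ.mem_nhds hx)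
    have h5 : ∅ ∈ 𝓝[≠] x := by
      filter_upwards [h3, h4] with z hz hz'
      rcases hz with hz | hz
      · simp at hz
      · exact hz hz'
    exact (NeBot.ne inferInstance) (empty_mem_iff_bot.1 h5)
  · rintro ⟨_, f, hf, rfl⟩ hne
    refine ⟨⟨_, f⁻¹, hf.inv, rfl⟩, Subtype.ext (Germ.coe_eq.2 ?_)⟩
    have hfin : ∀ x ∈ Ω, meromorphicOrderAt f x ≠ ⊤ := by
      intro x hx h
      exact hne (Subtype.ext (Germ.coe_eq.2 (key f hf x hx h)))
    rw [EventuallyEq, Filter.Eventually, mem_codiscreteWithin_iff_forall_mem_nhdsNE]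
    intro y hy
    have := (meromorphicOrderAt_ne_top_iff_eventually_ne_zero (hf y hy)).1 (hfin y hy)
    filter_upwards [this] with z hz
    exact Or.inl (mul_inv_cancel₀ hz)

/-! Fix `p ∈ Ω`; the order at `p` is a valuation. For a Polish ring topology its locus of infinite
order is closed, being an annihilator, and Dudley's argument makes the order `0` on a neighbourhood
of `1`: otherwise completeness solves `y n = x n * y (n + 1) ^ m (x n)`
(`exists_seq_eq_mul_pow_succ`), and the orders obey an impossible integer recursion. Translates of
this neighbourhood to the points `c / (z - p)` are then disjoint, since two elements of order `0`
differ by one without a pole at `p`; uncountably many of them contradict separability. -/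

/-- An integer sequence cannot satisfy `a n = b n + (|b n| + 2) * a (n + 1)` with all `b n ≠ 0`. -/
theorem Int.not_forall_eq_add_natAbs_add_two_mul (a b : ℕ → ℤ) (hb : ∀ n, b n ≠ 0) :
    ¬ ∀ n, a n = b n + ((b n).natAbs + 2 : ℕ) * a (n + 1) := by
  intro h
  have step : ∀ n, a (n + 1) ≠ 0 → |a (n + 1)| + 1 ≤ |a n| := by
    intro n hn
    have h1 : 1 ≤ |a (n + 1)| := Int.one_le_abs hn
    have h2 : |((b n).natAbs + 2 : ℕ) * a (n + 1)| ≤ |a n| + |b n| := by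
      have : (((b n).natAbs + 2 : ℕ) : ℤ) * a (n + 1) = a n - b n := by rw [h n]; ring
      rw [this]
      exact abs_sub _ _
    rw [abs_mul, Nat.abs_cast] at h2
    push_cast at h2
    -- As `|a (n + 1)| ≥ 1`, the term `|b n| * |a (n + 1)|` absorbs `|b n|`, leaving `2 * |a (n +
    -- 1)| ≤ |a n|`.
    nlinarith [abs_nonneg (b n), mul_nonneg (abs_nonneg (b n)) (sub_nonneg.2 h1)]
  have chain : ∀ n, a n ≠ 0 → |a n| + n ≤ |a 0| := by
    intro n
    induction n with
    | zero => intro _; simp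
    | succ k ih =>
      intro hk
      have h1 := step k hk
      have h2 : a k ≠ 0 := by
        intro h0
        rw [h0, abs_zero] at h1
        linarith [abs_nonneg (a (k + 1))]
      have h3 := ih h2
      push_cast
      linarith
  have bound : ∀ n : ℕ, (n : ℤ) ≤ |a 0| := by
    intro n
    -- Two consecutive terms cannot both vanish, as `b n ≠ 0`.
    by_cases h0 : a n = 0
    · have h1 : a (n + 1) ≠ 0 := by
        intro h1
        have := h n
        rw [h0, h1, mul_zero, add_zero] at this
        exact hb n this.symm
      have h2 := chain (n + 1) h1
      push_cast at h2
      linarith [abs_nonneg (a (n + 1))]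
    · linarith [chain n h0, abs_nonneg (a n)]
  have h1 := bound ((a 0).natAbs + 1)
  push_cast at h1
  linarith

/-- In a complete metric monoid, given a condition `P` satisfied by elements arbitrarily close
to `1` and exponents `m`, there are elements `x n` satisfying `P` and elements `y n`,
with `y 0` arbitrarily close to `1`, such that `y n = x n * y (n + 1) ^ m (x n)`. -/
theorem exists_seq_eq_mul_pow_succ {M : Type*} [Monoid M] [MetricSpace M] [CompleteSpace M]
    [ContinuousMul M] {P : M → Prop} (hP : ∃ᶠ x in 𝓝 (1 : M), P x) (m : M → ℕ)
    {r : ℝ} (hr : 0 < r) :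
    ∃ x y : ℕ → M, (∀ n, P (x n)) ∧ dist 1 (y 0) ≤ r ∧
      ∀ n, y n = x n * y (n + 1) ^ m (x n) := by
  have hstep : ∀ (F : ℕ → C(M, M)) (N : ℕ), ∃ x, P x ∧
      ∀ n ≤ N, dist (F n 1) (F n x) ≤ r / 2 / 2 ^ N := by
    intro F N
    have hev : ∀ᶠ x in 𝓝 (1 : M), ∀ n ∈ Finset.range (N + 1),
        dist (F n 1) (F n x) ≤ r / 2 / 2 ^ N := by
      rw [Filter.eventually_all_finset]
      intro n _
      have hc : Tendsto (fun x ↦ dist (F n 1) (F n x)) (𝓝 1) (𝓝 (dist (F n 1) (F n 1))) :=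
        (continuous_const.dist (F n).continuous).tendsto 1
      rw [dist_self] at hc
      exact hc.eventually_le_const (by positivity)
    obtain ⟨x, hx, hx'⟩ := (hP.and_eventually hev).exists
    exact ⟨x, hx, fun n hn ↦ hx' n (Finset.mem_range.2 (by omega))⟩
  choose g hgP hg using hstep
  let T : M → C(M, M) := fun x ↦ ⟨fun y ↦ x * y ^ m x, by fun_prop⟩
  -- `σ N n` is `T (x n) ∘ ⋯ ∘ T (x (N - 1))`, and `y n` will be the limit of `σ N n 1`. Each `x N`
  -- is chosen after the finitely many `σ N n`, so close to `1` that appending `T (x N)` barely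
  -- moves these values.
  let σ : ℕ → ℕ → C(M, M) := fun N ↦ Nat.rec (fun _ ↦ ContinuousMap.id M)
    (fun N F n ↦ if n ≤ N then (F n).comp (T (g F N)) else ContinuousMap.id M) N
  let x : ℕ → M := fun N ↦ g (σ N) N
  have σ_succ : ∀ N n, σ (N + 1) n =
      if n ≤ N then (σ N n).comp (T (x N)) else ContinuousMap.id M := fun _ _ ↦ rfl
  have σ_id : ∀ N n, N ≤ n → σ N n = ContinuousMap.id M := by
    intro N n h
    cases N with
    | zero => rfl
    | succ N => rw [σ_succ, if_neg (by omega)]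
  have σ_rec : ∀ n k, σ (n + 1 + k) n = (T (x n)).comp (σ (n + 1 + k) (n + 1)) := by
    intro n k
    induction k with
    | zero => rw [add_zero, σ_succ, if_pos le_rfl, σ_id n n le_rfl, σ_id (n + 1) _ le_rfl]; rfl
    | succ k ih =>
      rw [← add_assoc, σ_succ, if_pos (by omega), σ_succ, if_pos (by omega), ih]
      rfl
  have T_one : ∀ N, T (x N) 1 = x N := fun N ↦ by simp [T]
  have hdist : ∀ n N, dist (σ N n 1) (σ (N + 1) n 1) ≤ r / 2 / 2 ^ N := by
    intro n N
    rw [σ_succ]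
    split_ifs with h
    · rw [ContinuousMap.comp_apply, T_one]
      exact hg (σ N) N n h
    · rw [σ_id N n (by omega), dist_self]
      positivity
  have hlim : ∀ n, ∃ y, Tendsto (fun N ↦ σ N n 1) atTop (𝓝 y) := fun n ↦
    cauchySeq_tendsto_of_complete (cauchySeq_of_le_geometric_two (hdist n))
  choose y hy using hlim
  refine ⟨x, y, fun n ↦ hgP _ _, dist_le_of_le_geometric_two_of_tendsto₀ (hdist 0) (hy 0), ?_⟩
  intro n
  have h1 : Tendsto (fun k ↦ σ (n + 1 + k) n 1) atTop (𝓝 (y n)) :=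
    (hy n).comp (tendsto_atTop_mono (fun k ↦ Nat.le_add_left k (n + 1)) tendsto_id)
  have h2 : Tendsto (fun k ↦ σ (n + 1 + k) (n + 1) 1) atTop (𝓝 (y (n + 1))) :=
    (hy (n + 1)).comp (tendsto_atTop_mono (fun k ↦ Nat.le_add_left k (n + 1)) tendsto_id)
  have h3 := ((T (x n)).continuous.tendsto (y (n + 1))).comp h2
  refine tendsto_nhds_unique h1 (h3.congr fun k ↦ ?_)
  rw [σ_rec]
  rfl

/-- Automatic continuity at `1` of integer-valued multiplicative valuations on complete metric
monoids, after Dudley. -/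
theorem eventually_eq_zero_of_map_mul_eq_add {M : Type*} [Monoid M] [MetricSpace M]
    [CompleteSpace M] [ContinuousMul M] (v : M → WithTop ℤ) (v_one : v 1 = 0)
    (v_mul : ∀ x y, v (x * y) = v x + v y) (hv : IsClosed {x | v x = ⊤}) :
    ∀ᶠ x in 𝓝 (1 : M), v x = 0 := by
  by_contra hcon
  have v_pow : ∀ x n, v (x ^ n) = n • v x := by
    intro x n
    induction n with
    | zero => simp [v_one]
    | succ n ih => rw [pow_succ, v_mul, ih, succ_nsmul]
  have hopen : ∀ᶠ x in 𝓝 (1 : M), v x ≠ ⊤ :=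
    hv.isOpen_compl.mem_nhds (by simp [v_one])
  obtain ⟨r, hr, hball⟩ := Metric.eventually_nhds_iff.1 hopen
  have hfreq : ∃ᶠ x in 𝓝 (1 : M), v x ≠ 0 ∧ v x ≠ ⊤ :=
    (Filter.not_eventually.1 hcon).and_eventually hopen
  obtain ⟨x, y, hx, hy0, hy⟩ := exists_seq_eq_mul_pow_succ hfreq
    -- The default `0` is never used: every `v (x n)` is finite.
    (fun x ↦ ((v x).untopD 0).natAbs + 2) (half_pos hr)
  have hvy : ∀ n, v (y n) = v (x n) + (((v (x n)).untopD 0).natAbs + 2) • v (y (n + 1)) := by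
    intro n
    rw [← v_pow, ← v_mul, ← hy]
  have hyfin : ∀ n, v (y n) ≠ ⊤ := by
    intro n
    induction n with
    | zero => exact hball (by rw [dist_comm]; linarith)
    | succ n ih =>
      intro htop
      apply ih
      -- The exponent is positive, so infinite order would pass from `y (n + 1)` back to `y n`.
      rw [hvy, htop, succ_nsmul]
      simp
  choose a ha using fun n ↦ WithTop.ne_top_iff_exists.1 (hyfin n)
  choose b hb using fun n ↦ WithTop.ne_top_iff_exists.1 (hx n).2
  refine Int.not_forall_eq_add_natAbs_add_two_mul a b (fun n h0 ↦ (hx n).1 ?_) fun n ↦ ?_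
  · rw [← hb, h0]; rfl
  · have := hvy n
    rw [← ha n, ← ha (n + 1), ← hb n, WithTop.untopD_coe, ← WithTop.coe_nsmul,
      ← WithTop.coe_add] at this
    rw [WithTop.coe_injective this, nsmul_eq_mul]

/-- On an open set, equality modulo the codiscrete filter is equality near each point. -/
theorem IsOpen.eventuallyEq_codiscreteWithin_iff {Ω : Set ℂ} (hΩ : IsOpen Ω) {f g : ℂ → ℂ} :
    f =ᶠ[codiscreteWithin Ω] g ↔ ∀ p ∈ Ω, f =ᶠ[𝓝[≠] p] g := by
  rw [EventuallyEq, Filter.Eventually, mem_codiscreteWithin_iff_forall_mem_nhdsNE]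
  refine forall₂_congr fun p hp ↦ ⟨fun h ↦ ?_, fun h ↦ ?_⟩
  · filter_upwards [h, mem_nhdsWithin_of_mem_nhds (hΩ.mem_nhds hp)] with z hz hz'
    exact hz.resolve_right fun h ↦ h hz'
  · filter_upwards [h] with z hz
    exact Or.inl hz

namespace MeromorphicFunctions

variable {Ω : Set ℂ}

/-- The class in `ℳ(Ω)` of a meromorphic function. -/
noncomputable def mk (f : ℂ → ℂ) (hf : MeromorphicOn f Ω) : MeromorphicFunctions Ω := ⟨_, f, hf, rfl⟩

theorem exists_mk_eq (x : MeromorphicFunctions Ω) : ∃ f hf, mk f hf = x := by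
  obtain ⟨_, f, hf, rfl⟩ := x
  exact ⟨f, hf, rfl⟩

theorem mk_eq_mk_iff (hΩ : IsOpen Ω) {f g : ℂ → ℂ} (hf : MeromorphicOn f Ω)
    (hg : MeromorphicOn g Ω) : mk f hf = mk g hg ↔ ∀ p ∈ Ω, f =ᶠ[𝓝[≠] p] g := by
  rw [← hΩ.eventuallyEq_codiscreteWithin_iff, ← Germ.coe_eq]
  exact Subtype.ext_iff

/-- The order at a point of an element of `ℳ(Ω)`. -/
noncomputable def order (p : ℂ) (x : MeromorphicFunctions Ω) : WithTop ℤ :=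
  meromorphicOrderAt (exists_mk_eq x).choose p

theorem order_mk (hΩ : IsOpen Ω) {p : ℂ} (hp : p ∈ Ω) {f : ℂ → ℂ} (hf : MeromorphicOn f Ω) :
    order p (mk f hf) = meromorphicOrderAt f p := by
  obtain ⟨hg, h⟩ := (exists_mk_eq (mk f hf)).choose_spec
  exact meromorphicOrderAt_congr ((mk_eq_mk_iff hΩ hg hf).1 h p hp)

theorem order_one (hΩ : IsOpen Ω) {p : ℂ} (hp : p ∈ Ω) :
    order p (1 : MeromorphicFunctions Ω) = 0 := by
  have : order p (mk 1 (MeromorphicOn.const 1) : MeromorphicFunctions Ω) = 0 := by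
    rw [order_mk hΩ hp]
    exact (meromorphicOrderAt_const p (1 : ℂ)).trans (if_neg one_ne_zero)
  exact this

theorem order_mul (hΩ : IsOpen Ω) {p : ℂ} (hp : p ∈ Ω) (x y : MeromorphicFunctions Ω) :
    order p (x * y) = order p x + order p y := by
  obtain ⟨f, hf, rfl⟩ := exists_mk_eq x
  obtain ⟨g, hg, rfl⟩ := exists_mk_eq y
  rw [order_mk hΩ hp, order_mk hΩ hp, ← meromorphicOrderAt_mul (hf p hp) (hg p hp)]
  exact order_mk hΩ hp (hf.mul hg)

theorem min_order_le_order_sub (hΩ : IsOpen Ω) {p : ℂ} (hp : p ∈ Ω)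
    (x y : MeromorphicFunctions Ω) : min (order p x) (order p y) ≤ order p (x - y) := by
  obtain ⟨f, hf, rfl⟩ := exists_mk_eq x
  obtain ⟨g, hg, rfl⟩ := exists_mk_eq y
  have h : order p (mk f hf - mk g hg) = meromorphicOrderAt (f + -g) p := by
    rw [sub_eq_add_neg]
    exact order_mk hΩ hp (hf.add hg.neg)
  rw [order_mk hΩ hp, order_mk hΩ hp, h, show meromorphicOrderAt g p = meromorphicOrderAt (-g) p from meromorphicOrderAt_neg ..]
  exact meromorphicOrderAt_add (hf p hp) (hg p hp).neg

/-- The elements of infinite order at a point form the annihilator of the indicator function of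
the connected component of that point. -/
theorem exists_order_eq_top_iff_mul_eq_zero (hΩ : IsOpen Ω) {p : ℂ} (hp : p ∈ Ω) :
    ∃ e : MeromorphicFunctions Ω, ∀ x, order p x = ⊤ ↔ e * x = 0 := by
  classical
  set C := connectedComponentIn Ω p with hC
  have hCo : IsOpen C := hΩ.connectedComponentIn
  have hpC : p ∈ C := mem_connectedComponentIn hp
  have hin : ∀ q ∈ C, C.indicator (1 : ℂ → ℂ) =ᶠ[𝓝 q] 1 := fun q hq ↦ by
    filter_upwards [hCo.mem_nhds hq] with z hz
    exact Set.indicator_of_mem hz _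
  have hout : ∀ q ∈ Ω, q ∉ C → C.indicator (1 : ℂ → ℂ) =ᶠ[𝓝 q] 0 := fun q hq hqC ↦ by
    have hdisj : Disjoint (connectedComponentIn Ω q) C := by
      refine Set.disjoint_left.2 fun z hzq hzC ↦ hqC ?_
      rw [hC, connectedComponentIn_eq hzC, ← connectedComponentIn_eq hzq]
      exact mem_connectedComponentIn hq
    filter_upwards [hΩ.connectedComponentIn.mem_nhds (mem_connectedComponentIn hq)] with z hz
    exact Set.indicator_of_notMem (Set.disjoint_left.1 hdisj hz) _
  have hmer : MeromorphicOn (C.indicator (1 : ℂ → ℂ)) Ω := fun q hq ↦ by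
    by_cases hqC : q ∈ C
    · exact (MeromorphicAt.const 1 q).congr ((hin q hqC).symm.filter_mono nhdsWithin_le_nhds)
    · exact (MeromorphicAt.const 0 q).congr
        ((hout q hq hqC).symm.filter_mono nhdsWithin_le_nhds)
  refine ⟨mk _ hmer, fun x ↦ ?_⟩
  obtain ⟨f, hf, rfl⟩ := exists_mk_eq x
  have hmul : mk _ hmer * mk f hf = 0 ↔
      ∀ q ∈ Ω, C.indicator (1 : ℂ → ℂ) * f =ᶠ[𝓝[≠] q] 0 :=
    mk_eq_mk_iff hΩ (hmer.mul hf) (MeromorphicOn.const 0)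
  rw [order_mk hΩ hp, hmul]
  constructor
  · intro h q hq
    by_cases hqC : q ∈ C
    -- Identity theorem on the component `C`.
    · have hqtop : meromorphicOrderAt f q = ⊤ := by
        by_contra hne
        exact (hf.mono_set (connectedComponentIn_subset Ω p)
          ).meromorphicOrderAt_ne_top_of_isPreconnected isPreconnected_connectedComponentIn
          hqC hpC hne h
      filter_upwards [meromorphicOrderAt_eq_top_iff.1 hqtop] with z hz
      simp [hz]
    · filter_upwards [(hout q hq hqC).filter_mono nhdsWithin_le_nhds] with z hz
      simp [hz]
  · intro h
    rw [meromorphicOrderAt_eq_top_iff]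
    filter_upwards [h p hp, (hin p hpC).filter_mono nhdsWithin_le_nhds] with z hz hz'
    simpa [hz'] using hz

/-- Uncountably many elements of `ℳ(Ω)` have pairwise differences with a pole at a given point. -/
theorem exists_order_sub_lt_zero (hΩ : IsOpen Ω) {p : ℂ} (hp : p ∈ Ω) :
    ∃ s : ℂ → MeromorphicFunctions Ω, ∀ c d, c ≠ d → order p (s c - s d) < 0 := by
  have hmer : ∀ c : ℂ, MeromorphicOn (fun z ↦ c * (z - p)⁻¹) Ω := fun c q _ ↦ by fun_prop
  refine ⟨fun c ↦ mk _ (hmer c), fun c d hcd ↦ ?_⟩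
  have h : mk _ (hmer c) - mk _ (hmer d) = mk _ (hmer (c - d)) := by
    refine (mk_eq_mk_iff hΩ ((hmer c).sub (hmer d)) (hmer (c - d))).2 fun q _ ↦ ?_
    exact Eventually.of_forall fun z ↦ (sub_mul c d _).symm
  have hord : meromorphicOrderAt (fun z ↦ (c - d) * (z - p)⁻¹) p = ((-1 : ℤ) : WithTop ℤ) := by
    rw [meromorphicOrderAt_eq_int_iff (hmer (c - d) p hp)]
    refine ⟨fun _ ↦ c - d, analyticAt_const, sub_ne_zero.2 hcd, Eventually.of_forall fun z ↦ ?_⟩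
    rw [zpow_neg_one, smul_eq_mul, mul_comm]
  rw [h, order_mk hΩ hp, hord]
  exact WithTop.coe_lt_coe.2 (by norm_num)

/-- The ring `ℳ(Ω)` carries no Polish ring topology. -/
theorem not_polishSpace (hΩ : IsOpen Ω) (hne : Ω.Nonempty)
    [TopologicalSpace (MeromorphicFunctions Ω)] [IsTopologicalRing (MeromorphicFunctions Ω)] :
    ¬ PolishSpace (MeromorphicFunctions Ω) := by
  intro hpol
  obtain ⟨p, hp⟩ := hne
  have hclosed : IsClosed {x : MeromorphicFunctions Ω | order p x = ⊤} := by
    obtain ⟨e, he⟩ := exists_order_eq_top_iff_mul_eq_zero hΩ hp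
    simp only [he]
    exact isClosed_eq (by fun_prop) continuous_const
  have hnear : ∀ᶠ x in 𝓝 (1 : MeromorphicFunctions Ω), order p x = 0 := by
    let := TopologicalSpace.upgradeIsCompletelyMetrizable (MeromorphicFunctions Ω)
    exact eventually_eq_zero_of_map_mul_eq_add _ (order_one hΩ hp) (order_mul hΩ hp) hclosed
  obtain ⟨U, hU, hUo, hU1⟩ := mem_nhds_iff.1 hnear
  obtain ⟨s, hs⟩ := exists_order_sub_lt_zero hΩ hp
  let W : ℂ → Set (MeromorphicFunctions Ω) := fun c ↦ (fun x ↦ x - s c + 1) ⁻¹' U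
  have hdisj : Pairwise (Function.onFun Disjoint W) := by
    intro c d hcd
    refine Set.disjoint_left.2 fun x hc hd ↦ (hs c d hcd).not_ge ?_
    -- The difference of these two elements is `s c - s d`, which has a pole at `p`.
    have h := min_order_le_order_sub hΩ hp (x - s d + 1) (x - s c + 1)
    rw [show order p (x - s d + 1) = 0 from hU hd, show order p (x - s c + 1) = 0 from hU hc,
      min_self] at h
    convert h using 2
    ring
  have hcount : Countable ℂ := hdisj.countable_of_isOpen_disjoint
    (fun c ↦ hUo.preimage (by fun_prop)) fun c ↦ ⟨s c, by simpa [W] using hU1⟩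
  exact not_countable_complex (Set.countable_univ_iff.2 hcount)

end MeromorphicFunctions

theorem mainTheorem4 (Ω : Set ℂ) (hΩ : IsOpen Ω) (hne : Ω.Nonempty) :
    (IsConnected Ω → IsField (MeromorphicFunctions Ω)) ∧
      ¬ ∃ τ : TopologicalSpace (MeromorphicFunctions Ω),
        @PolishSpace (MeromorphicFunctions Ω) τ ∧
          @IsTopologicalRing (MeromorphicFunctions Ω) τ _ := by
  refine ⟨MeromorphicFunctions.isField hΩ, ?_⟩
  rintro ⟨τ, hpol, hring⟩
  exact MeromorphicFunctions.not_polishSpace hΩ hne hpol
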